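/- Let $E$ be a finite set and $\mathbb T=\mathbb R\cup\{\infty\}$. A valuated matroid $\mu$ on $E$ with underlying matroid $M$ is a function $\mu$ from the subsets of $E$ to $\mathbb T$ which is finite exactly on the bases of $M$ and such that for all bases $B,B'$ of $M$ and $i\in B\setminus B'$ there is $j\in B'\setminus B$ with $\mu(B)+\mu(B')\ge \mu((B\setminus i)\cup j)+\mu((B'\setminus j)\cup i)$. If $\mu,\nu$ are valuated matroids on $E$ with underlying matroids $M,N$, then $\mu$ is a (valuated) quotient of $\nu$, written $\mu\twoheadleftarrow\nu$ or $\nu\twoheadrightarrow\mu$, if $\operatorname{rk}M\le\operatorname{rk}N$ and for every basis $I$ of $M$, every basis $J$ of $N$ and every $i\in I\setminus J$ there is $j\in J\setminus I$ with $\mu(I)+\nu(J)\ge\mu((I\setminus i)\cup j)+\nu((J\setminus j)\cup i)$. For $S\subseteq E$, the contraction $\mu/S$ is the valuated matroid on $E\setminus S$ with underlying matroid $M/S$ given by $(\mu/S)(I)=\mu(I\cup K)$, where $K$ is a fixed basis of $S$ in $M$; the deletion $\mu\setminus S$ is the valuated matroid on $E\setminus S$ with underlying matroid $M\setminus S$ given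 by $(\mu\setminus S)(I)=\mu(I\cup L)$, where $L$ is a fixed basis of $M/(E\setminus S)$. Other choices of $K$ and $L$ change these functions only by a global additive constant, which does not affect the notion of quotient. A matroid $M$ on $E$ is a quotient of a matroid $N$ on $E$, written $M\twoheadleftarrow N$, if $\operatorname{rk}_M(B)-\operatorname{rk}_M(A)\le\operatorname{rk}_N(B)-\operatorname{rk}_N(A)$ for all $A\subseteq B\subseteq E$. Corollary. Let $\mu,\nu,\xi$ be valuated matroids on $E$, and let $M,N$ be the underlying matroids of $\mu,\nu$. 1. If $\mu\twoheadrightarrow\nu$ and $\nu\twoheadrightarrow\xi$, then $\mu\twoheadrightarrow\xi$. 2. If $\mu\twoheadleftarrow\nu$, then $\mu/S\twoheadleftarrow\nu/S$ and $\mu\setminus S\twoheadleftarrow\nu\setminus S$ for every $S\subseteq E$. 3. For every $S\subseteq E$, $\mu/S\twoheadleftarrow\mu\setminus S$. 4. If $\mu\twoheadleftarrow\nu$, then $M\twoheadleftarrow N$. -/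

import Mathlib

open Set

/-- The rank function of a matroid on a finite ground set, as an integer. -/
noncomputable def Matroid.intRk {α : Type*} (M : Matroid α) (X : Set α) : ℤ :=
  ((M.eRk X).toNat : ℤ)

/-- `M.IsQuotientOf N`: the matroid `M` is a quotient of the matroid `N` on the same ground set,
that is `rk_M(B) - rk_M(A) ≤ rk_N(B) - rk_N(A)` for all `A ⊆ B ⊆ E`.
(Used for matroids on a finite ground set.) -/
def Matroid.IsQuotientOf {α : Type*} (M N : Matroid α) : Prop :=
  M.E = N.E ∧ ∀ A B : Set α, A ⊆ B → B ⊆ M.E →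
    M.intRk B - M.intRk A ≤ N.intRk B - N.intRk A

/-- A valuated matroid on a finite ground set `E = matroid.E`, seen as a function with values in the
tropical semifield `𝕋 = ℝ ∪ {∞}` that is finite exactly on the bases of its underlying matroid. -/
structure ValuatedMatroid (α : Type*) where
  /-- The underlying matroid. -/
  matroid : Matroid α
  /-- The ground set is finite. -/
  finite_ground : matroid.E.Finite
  /-- The valuation. -/
  val : Set α → WithTop ℝ
  val_ne_top_iff : ∀ B, val B ≠ ⊤ ↔ matroid.IsBase B
  exchange : ∀ B B', matroid.IsBase B → matroid.IsBase B' → ∀ i ∈ B \ B', ∃ j ∈ B' \ B,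
    val (insert j (B \ {i})) + val (insert i (B' \ {j})) ≤ val B + val B'

/-- If `K` is a basis of `S` in `M`, the bases of `M / S` are the sets `I` disjoint from `S` such
that `I ∪ K` is a basis of `M`. -/
theorem Matroid.IsBasis'.isBase_contract_iff {α : Type*} {M : Matroid α} {K S : Set α}
    (hK : M.IsBasis' K S) (I : Set α) :
    (M.contract S).IsBase I ↔ Disjoint I S ∧ M.IsBase (I ∪ K) := by
  have hmax : ∀ J, M.Indep J → K ⊆ J → J ∩ S = K := by
    intro J hJ hKJ
    exact (hK.eq_of_subset_indep (hJ.subset inter_subset_left)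
      (subset_inter hKJ hK.subset) inter_subset_right).symm
  constructor
  · intro hI
    obtain ⟨hIK, hdisj⟩ := hK.contract_indep_iff.1 hI.indep
    obtain ⟨B, hB, hIB⟩ := hIK.exists_isBase_superset
    have hBS : B ∩ S = K := hmax B hB.indep (subset_union_right.trans hIB)
    have hBK : (B \ S) ∪ K = B := by rw [← hBS, sdiff_union_inter]
    have hind : (M.contract S).Indep (B \ S) :=
      hK.contract_indep_iff.2 ⟨by rw [hBK]; exact hB.indep, disjoint_sdiff_right⟩
    have hIBS : I ⊆ B \ S := fun x hx ↦
      ⟨hIB (Or.inl hx), fun hxS ↦ (disjoint_left.1 hdisj) hxS hx⟩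
    have := hI.eq_of_subset_indep hind hIBS
    refine ⟨hdisj.symm, ?_⟩
    rw [this, hBK]
    exact hB
  · rintro ⟨hdisj, hB⟩
    rw [Matroid.isBase_iff_maximal_indep]
    refine ⟨hK.contract_indep_iff.2 ⟨hB.indep, hdisj.symm⟩, ?_⟩
    intro J hJ hIJ x hx
    obtain ⟨hJK, hJS⟩ := hK.contract_indep_iff.1 hJ
    have := hB.eq_of_subset_indep hJK (union_subset_union_left K hIJ)
    have hx' : x ∈ I ∪ K := by rw [this]; exact Or.inl hx
    rcases hx' with h | h
    · exact h
    · exact absurd hx ((disjoint_left.1 hJS) (hK.subset h))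

/-- If `L` is a basis of `M / (E \ S)`, the bases of `M \ S` are the sets `I` disjoint from `S` such
that `I ∪ L` is a basis of `M`. -/
theorem Matroid.isBase_delete_iff_of_isBase_contract {α : Type*} {M : Matroid α} {L S : Set α}
    (hL : (M.contract (M.E \ S)).IsBase L) (I : Set α) :
    (M.delete S).IsBase I ↔ Disjoint I S ∧ M.IsBase (I ∪ L) := by
  rw [Matroid.delete_isBase_iff]
  constructor
  · intro hI
    have h := (hI.isBasis'.isBase_contract_iff L).1 hL
    refine ⟨disjoint_left.2 fun x hx ↦ (hI.subset hx).2, ?_⟩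
    rw [union_comm]
    exact h.2
  · rintro ⟨hdisj, hB⟩
    have hsub : I ⊆ M.E \ S := fun x hx ↦
      ⟨hB.subset_ground (Or.inl hx), disjoint_left.1 hdisj hx⟩
    obtain ⟨I', hI', hII'⟩ := (hB.indep.subset subset_union_left).subset_isBasis_of_subset hsub
    obtain ⟨hd, hB'⟩ := (hI'.isBasis'.isBase_contract_iff L).1 hL
    have heq := hB.eq_of_subset_isBase hB' (by
      rw [union_comm]; exact union_subset_union_right L hII')
    have : I' ⊆ I := by
      intro x hx
      have hx' : x ∈ I ∪ L := by rw [heq]; exact Or.inr hx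
      exact hx'.resolve_right fun h ↦ disjoint_left.1 hd h (hI'.subset hx)
    rw [subset_antisymm hII' this]
    exact hI'

namespace ValuatedMatroid

variable {α : Type*}

/-- The ground set. -/
def E (μ : ValuatedMatroid α) : Set α := μ.matroid.E

/-- `μ.IsQuotient ν`: the valuated matroid `μ` is a valuated quotient of `ν`. -/
def IsQuotient (μ ν : ValuatedMatroid α) : Prop :=
  μ.E = ν.E ∧ μ.matroid.eRank ≤ ν.matroid.eRank ∧
    ∀ I J, μ.matroid.IsBase I → ν.matroid.IsBase J → ∀ i ∈ I \ J, ∃ j ∈ J \ I,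
      μ.val (insert j (I \ {i})) + ν.val (insert i (J \ {j})) ≤ μ.val I + ν.val J

open Classical in
/-- The valuated matroid `I ↦ μ (I ∪ K)` on the subsets `I` disjoint from `S`, where `K ⊆ S` is a
fixed set, with underlying matroid `N`. -/
noncomputable def slice (μ : ValuatedMatroid α) (S K : Set α) (N : Matroid α) (hKS : K ⊆ S)
    (hE : N.E ⊆ μ.matroid.E)
    (hN : ∀ I, N.IsBase I ↔ Disjoint I S ∧ μ.matroid.IsBase (I ∪ K)) : ValuatedMatroid α where
  matroid := N
  finite_ground := μ.finite_ground.subset hE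
  val I := if Disjoint I S then μ.val (I ∪ K) else ⊤
  val_ne_top_iff I := by
    rw [hN]
    split_ifs with h
    · simp [h, μ.val_ne_top_iff]
    · simp [h]
  exchange I I' hI hI' i hi := by
    obtain ⟨hd, hB⟩ := (hN I).1 hI
    obtain ⟨hd', hB'⟩ := (hN I').1 hI'
    have hiS : i ∉ S := disjoint_left.1 hd hi.1
    have hiK : i ∉ K := fun h ↦ hiS (hKS h)
    obtain ⟨j, hj, hle⟩ := μ.exchange _ _ hB hB' i
      ⟨Or.inl hi.1, fun h ↦ h.elim hi.2 hiK⟩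
    have hjK : j ∉ K := fun h ↦ hj.2 (Or.inr h)
    have hjI' : j ∈ I' := hj.1.resolve_right hjK
    have hjS : j ∉ S := disjoint_left.1 hd' hjI'
    refine ⟨j, ⟨hjI', fun h ↦ hj.2 (Or.inl h)⟩, ?_⟩
    have h1 : Disjoint (insert j (I \ {i})) S :=
      disjoint_insert_left.2 ⟨hjS, hd.mono_left sdiff_subset⟩
    have h2 : Disjoint (insert i (I' \ {j})) S :=
      disjoint_insert_left.2 ⟨hiS, hd'.mono_left sdiff_subset⟩
    rw [if_pos h1, if_pos h2, if_pos hd, if_pos hd', insert_union, insert_union]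
    rwa [union_sdiff_distrib, union_sdiff_distrib, sdiff_singleton_eq_self hiK,
      sdiff_singleton_eq_self hjK] at hle

/-- The contraction `μ / S`: a valuated matroid on `E \ S` with underlying matroid `M / S`, given by
`(μ / S)(I) = μ(I ∪ K)` for a basis `K` of `S` in `M`. Another choice of `K` changes it only by a
global additive constant. -/
noncomputable def contract (μ : ValuatedMatroid α) (S : Set α) : ValuatedMatroid α :=
  μ.slice S (μ.matroid.exists_isBasis' S).choose (μ.matroid.contract S)
    (μ.matroid.exists_isBasis' S).choose_spec.subset sdiff_subset
    (μ.matroid.exists_isBasis' S).choose_spec.isBase_contract_iff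

/-- The deletion `μ \ S`, which is also the restriction of `μ` to `E \ S`: a valuated matroid on
`E \ S` with underlying matroid `M \ S`, given by `(μ \ S)(I) = μ(I ∪ L)` for a basis `L` of
`M / (E \ S)`. Another choice of `L` changes it only by a global additive constant. -/
noncomputable def delete (μ : ValuatedMatroid α) (S : Set α) : ValuatedMatroid α :=
  μ.slice S (μ.matroid.contract (μ.matroid.E \ S)).exists_isBase.choose (μ.matroid.delete S)
    (fun _ hx ↦ by_contra fun hxS ↦
      have h := (μ.matroid.contract (μ.matroid.E \ S)).exists_isBase.choose_spec.subset_ground hx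
      h.2 ⟨h.1, hxS⟩)
    sdiff_subset
    (Matroid.isBase_delete_iff_of_isBase_contract
      (μ.matroid.contract (μ.matroid.E \ S)).exists_isBase.choose_spec)

theorem slice_step (μ : ValuatedMatroid α) {S K K' L L' : Set α} {i j : α}
    (hK : μ.matroid.IsBasis' K S) (hK' : μ.matroid.IsBasis' K' S)
    (hL : (μ.matroid.contract S).IsBase L) (hL' : (μ.matroid.contract S).IsBase L')
    (hi : i ∈ L) (hj : j ∉ L) (h : L' = insert j (L \ {i})) (hi' : i ∉ L') :
    μ.val (L' ∪ K) + μ.val (L ∪ K') ≤ μ.val (L ∪ K) + μ.val (L' ∪ K') := by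
  obtain ⟨hd, hB⟩ := (hK.isBase_contract_iff L).1 hL
  obtain ⟨hd', hB'⟩ := (hK'.isBase_contract_iff L').1 hL'
  have hiS : i ∉ S := disjoint_left.1 hd hi
  have hiK : i ∉ K := fun h ↦ hiS (hK.subset h)
  have hiK' : i ∉ K' := fun h ↦ hiS (hK'.subset h)
  have hjL' : j ∈ L' := by rw [h]; exact Or.inl rfl
  have hjS : j ∉ S := disjoint_left.1 hd' hjL'
  obtain ⟨k, hk, hle⟩ := μ.exchange _ _ hB hB' i ⟨Or.inl hi, fun h ↦ h.elim hi' hiK'⟩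
  have htop : μ.val (insert k ((L ∪ K) \ {i})) ≠ ⊤ := by
    intro ht
    rw [ht, top_add, top_le_iff, WithTop.add_eq_top] at hle
    exact hle.elim ((μ.val_ne_top_iff _).2 hB) ((μ.val_ne_top_iff _).2 hB')
  have hkb := ((μ.val_ne_top_iff _).1 htop).indep
  have hkK' : k ∉ K' := by
    intro hkK'
    have hsub : insert k K ⊆ insert k ((L ∪ K) \ {i}) := insert_subset_insert fun x hx ↦
      ⟨Or.inr hx, fun hxi ↦ hiK (hxi ▸ hx)⟩
    have := hK.eq_of_subset_indep (hkb.subset hsub) (subset_insert _ _)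
      (insert_subset (hK'.subset hkK') hK.subset)
    exact hk.2 (Or.inr (this ▸ mem_insert k K))
  have hkj : k = j := by
    have hkL' := hk.1.resolve_right hkK'
    rw [h] at hkL'
    exact hkL'.resolve_right fun hx ↦ hk.2 (Or.inl hx.1)
  subst hkj
  have e1 : insert k ((L ∪ K) \ {i}) = L' ∪ K := by
    rw [h, insert_union, union_sdiff_distrib, sdiff_singleton_eq_self hiK]
  have e2 : insert i ((L' ∪ K') \ {k}) = L ∪ K' := by
    rw [union_sdiff_distrib, sdiff_singleton_eq_self hkK', h,
      insert_sdiff_self_of_notMem (fun hx ↦ hj hx.1), ← insert_union,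
      insert_sdiff_singleton, insert_eq_of_mem hi]
  rwa [e1, e2] at hle

/-- The values `μ (L ∪ K)`, for `K` a basis of `S` and `L` a basis of `M / S`, split as a sum of a
function of `K` and a function of `L`. -/
theorem val_add_val (μ : ValuatedMatroid α) {S K K' L' : Set α}
    (hK : μ.matroid.IsBasis' K S) (hK' : μ.matroid.IsBasis' K' S)
    (hL' : (μ.matroid.contract S).IsBase L') (n : ℕ) :
    ∀ L, (μ.matroid.contract S).IsBase L → (L \ L').ncard = n →
      μ.val (L ∪ K) + μ.val (L' ∪ K') = μ.val (L' ∪ K) + μ.val (L ∪ K') := by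
  induction n with
  | zero =>
    intro L hL h0
    have hfin : (L \ L').Finite :=
      μ.finite_ground.subset fun x hx ↦ (hL.subset_ground hx.1).1
    rw [Set.ncard_eq_zero hfin, sdiff_eq_empty] at h0
    rw [hL.eq_of_subset_isBase hL' h0]
  | succ n ih =>
    intro L hL hn
    have hfin : (L \ L').Finite :=
      μ.finite_ground.subset fun x hx ↦ (hL.subset_ground hx.1).1
    obtain ⟨i, hi⟩ : (L \ L').Nonempty := by
      rw [nonempty_iff_ne_empty]; rintro h; simp [h] at hn
    obtain ⟨j, hj, hL1⟩ := hL.exchange hL' hi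
    have hij : i ≠ j := fun h ↦ hj.2 (h ▸ hi.1)
    have hi1 : i ∉ insert j (L \ {i}) := by simp [hij]
    have hcard : (insert j (L \ {i}) \ L').ncard = n := by
      have : insert j (L \ {i}) \ L' = (L \ L') \ {i} := by
        ext x
        simp only [mem_sdiff, mem_insert_iff, mem_singleton_iff]
        constructor
        · rintro ⟨rfl | h, h'⟩
          · exact absurd hj.1 h'
          · exact ⟨⟨h.1, h'⟩, h.2⟩
        · rintro ⟨⟨h, h'⟩, h''⟩
          exact ⟨Or.inr ⟨h, h''⟩, h'⟩
      rw [this, Set.ncard_sdiff_singleton_of_mem hi, hn]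
      rfl
    have h1 := ih _ hL1 hcard
    have h2 := μ.slice_step hK hK' hL hL1 hi.1 hj.2 rfl hi1
    have h3 := μ.slice_step hK' hK hL hL1 hi.1 hj.2 rfl hi1
    have key : ∀ {X P}, μ.matroid.IsBasis' P S → (μ.matroid.contract S).IsBase X →
        ∃ r : ℝ, μ.val (X ∪ P) = r := fun hP hX ↦
      ⟨_, (WithTop.coe_untop _
        ((μ.val_ne_top_iff _).2 ((hP.isBase_contract_iff _).1 hX).2)).symm⟩
    obtain ⟨a, ha⟩ := key hK hL
    obtain ⟨b, hb⟩ := key hK' hL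
    obtain ⟨c, hc⟩ := key hK hL1
    obtain ⟨d, hd⟩ := key hK' hL1
    obtain ⟨e, he⟩ := key hK hL'
    obtain ⟨f, hf⟩ := key hK' hL'
    rw [hc, hd, he, hf] at h1
    rw [ha, hb, hc, hd] at h2 h3
    rw [ha, hb, he, hf]
    norm_cast at h1 h2 h3 ⊢
    linarith

/-- The characterization of restriction and contraction through the face of `μ` on which
`∑_{i ∉ S} x_i` is minimal: on the bases in this face, `μ` is the sum of its restriction to `S` and
its contraction by `S`, up to a global additive constant. -/
theorem val_eq_restrict_add_contract (μ : ValuatedMatroid α) (S : Set α) (hS : S ⊆ μ.E) :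
    ∃ c : ℝ, ∀ B, μ.matroid.IsBase B →
      (∀ B', μ.matroid.IsBase B' → (B \ S).ncard ≤ (B' \ S).ncard) →
      μ.val B = (μ.delete (μ.E \ S)).val (B ∩ S) + (μ.contract S).val (B \ S) + c := by
  have hES : μ.matroid.E \ (μ.E \ S) = S := sdiff_sdiff_cancel_left hS
  obtain ⟨K₀, hK₀, hcv⟩ : ∃ K₀, μ.matroid.IsBasis' K₀ S ∧
      ∀ I, Disjoint I S → (μ.contract S).val I = μ.val (I ∪ K₀) :=
    ⟨_, (μ.matroid.exists_isBasis' S).choose_spec, fun I hI ↦ if_pos hI⟩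
  obtain ⟨L₀, hL₀, hdv⟩ : ∃ L₀, (μ.matroid.contract S).IsBase L₀ ∧
      ∀ I, Disjoint I (μ.E \ S) → (μ.delete (μ.E \ S)).val I = μ.val (I ∪ L₀) := by
    obtain ⟨L, hL, hv⟩ : ∃ L, (μ.matroid.contract (μ.matroid.E \ (μ.E \ S))).IsBase L ∧
        ∀ I, Disjoint I (μ.E \ S) → (μ.delete (μ.E \ S)).val I = μ.val (I ∪ L) :=
      ⟨_, Exists.choose_spec _, fun I hI ↦ if_pos hI⟩
    rw [hES] at hL
    exact ⟨L, hL, hv⟩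
  have key : ∀ {X P}, μ.matroid.IsBasis' P S → (μ.matroid.contract S).IsBase X →
      ∃ r : ℝ, μ.val (X ∪ P) = r := fun hP hX ↦
    ⟨_, (WithTop.coe_untop _
      ((μ.val_ne_top_iff _).2 ((hP.isBase_contract_iff _).1 hX).2)).symm⟩
  obtain ⟨c, hc⟩ := key hK₀ hL₀
  refine ⟨-c, fun B hB hmin ↦ ?_⟩
  have hBS : μ.matroid.IsBasis' (B ∩ S) S := by
    obtain ⟨K, hK, hBK⟩ := (hB.indep.subset inter_subset_left).subset_isBasis'_of_subset
      (inter_subset_right (s := B) (t := S))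
    obtain ⟨B', hB', hKB', hB'u⟩ := hK.indep.exists_isBase_subset_union_isBase hB
    have hf : ∀ {X : Set α}, μ.matroid.IsBase X → X.Finite := fun hX ↦
      μ.finite_ground.subset hX.subset_ground
    have hsub : B' \ S ⊆ B \ S := fun x hx ↦
      ⟨(hB'u hx.1).resolve_left fun h ↦ hx.2 (hK.subset h), hx.2⟩
    have heq : B' \ S = B \ S :=
      Set.eq_of_subset_of_ncard_le hsub (hmin B' hB') (hf hB).sdiff
    have hBB' : B = B' := hB.eq_of_subset_isBase hB' fun x hx ↦ by
      by_cases hxS : x ∈ S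
      · exact hKB' (hBK ⟨hx, hxS⟩)
      · have : x ∈ B' \ S := by rw [heq]; exact ⟨hx, hxS⟩
        exact this.1
    have : B ∩ S = K := subset_antisymm hBK (subset_inter (by rw [hBB']; exact hKB') hK.subset)
    rwa [this]
  have hdisj : Disjoint (B \ S) S := disjoint_sdiff_left
  have hL : (μ.matroid.contract S).IsBase (B \ S) :=
    (hBS.isBase_contract_iff _).2 ⟨hdisj, by rwa [sdiff_union_inter]⟩
  have h := μ.val_add_val hBS hK₀ hL₀ _ _ hL rfl
  rw [hcv _ hdisj, hdv _ (disjoint_left.2 fun x hx hx' ↦ hx'.2 hx.2), union_comm (B ∩ S) L₀]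
  obtain ⟨p, hp⟩ := key hBS hL
  obtain ⟨q, hq⟩ := key hBS hL₀
  obtain ⟨r, hr⟩ := key hK₀ hL
  rw [hp, hq, hr, hc] at h
  rw [hq, hr]
  rw [sdiff_union_inter] at hp
  rw [hp]
  norm_cast at h ⊢
  linarith

end ValuatedMatroid

/-! Transitivity is the hard point. Fix a basis `I` of `ξ` and `i ∈ I`, and let `x k = ξ(I - i +
k)`, a valuated cocircuit of `ξ`. As `ξ` is a quotient of `ν`, this `x` is orthogonal to all
valuated circuits of `ν`. By `exists_isBase_forall_le` a translate of a cocircuit `k ↦ ν(B - i + k)`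
of `ν` dominates `x` and equals it at `i`. Exchanging `i` between `B` and a basis `J` of `μ` and
adding the two inequalities cancels `ν` and leaves the exchange between `I` and `J`.

Contraction and deletion are slices of the valuation, so exchanges are inherited as long as the
element returned avoids the fixed part; maximality of bases of `S`, or of `E \ S`, ensures this
(`slice_exchange`).

For underlying matroids, exchange forces `N`-closures into `M`-closures, which yields the rank
inequality. That inequality also supplies the rank condition for minors of a quotient. -/

/-! ### Matroid quotients: exchange, closures and ranks. -/

namespace Matroid

variable {α : Type*} {M N : Matroid α}

/-- If any basis of `M` and any basis of `N` satisfy the exchange property of a quotient, then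
closures in `N` are contained in closures in `M`. -/
theorem closure_subset_closure_of_exchange (hE : M.E = N.E)
    (h : ∀ I J, M.IsBase I → N.IsBase J → ∀ i ∈ I \ J, ∃ j ∈ J \ I,
      M.IsBase (insert j (I \ {i})) ∧ N.IsBase (insert i (J \ {j})))
    {X : Set α} (hX : X ⊆ M.E) : N.closure X ⊆ M.closure X := by
  intro e heN
  by_contra heM
  have heE : e ∈ M.E := hE ▸ N.closure_subset_ground X heN
  have heX : e ∉ X := fun hx ↦ heM (M.mem_closure_of_mem hx hX)
  obtain ⟨K, hK⟩ := M.exists_isBasis X hX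
  obtain ⟨L, hL⟩ := N.exists_isBasis X (hE ▸ hX)
  have heK : e ∉ K := fun hx ↦ heX (hK.subset hx)
  have heL : e ∉ L := fun hx ↦ heX (hL.subset hx)
  rw [← hK.closure_eq_closure, hK.indep.notMem_closure_iff_of_notMem heK] at heM
  rw [← hL.closure_eq_closure] at heN
  obtain ⟨I, hI, hKI⟩ := heM.exists_isBase_superset
  obtain ⟨J, hJ, hLJ⟩ := hL.indep.exists_isBase_superset
  have heI : e ∈ I := hKI (mem_insert e K)
  have heJ : e ∉ J := fun hx ↦
    ((hL.indep.mem_closure_iff_of_notMem heL).1 heN).not_indep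
      (hJ.indep.subset (insert_subset hx hLJ))
  obtain ⟨j, hj, hIj, hJj⟩ := h I J hI hJ e ⟨heI, heJ⟩
  -- If `j ∉ L`, the exchanged basis of `N` contains `L + e`, which is dependent as `e` lies in the
  -- `N`-closure of `L`. So `j ∈ X`, and maximality of `K` in `X` will put `j` in `K ⊆ I`.
  have hjL : j ∈ L := by
    by_contra hjL
    refine ((hL.indep.mem_closure_iff_of_notMem heL).1 heN).not_indep
      (hJj.indep.subset (insert_subset_insert fun x hx ↦ ⟨hLJ hx, ?_⟩))
    rintro rfl
    exact hjL hx
  have hKj : M.Indep (insert j K) :=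
    hIj.indep.subset (insert_subset_insert fun x hx ↦
      ⟨hKI (mem_insert_of_mem e hx), fun hxe ↦ heK (hxe ▸ hx)⟩)
  have hjK := hK.mem_of_insert_indep (hL.subset hjL) hKj
  exact hj.2 (hKI (mem_insert_of_mem e hjK))

/-- If closures in `N` are contained in closures in `M`, then ranks of `M` grow at most as fast as
ranks of `N`. -/
theorem eRk_add_eRk_le_of_closure_subset (hE : M.E = N.E)
    (h : ∀ X, X ⊆ M.E → N.closure X ⊆ M.closure X) {A B : Set α} (hAB : A ⊆ B) (hB : B ⊆ M.E) :
    M.eRk B + N.eRk A ≤ M.eRk A + N.eRk B := by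
  obtain ⟨K, hK⟩ := N.exists_isBasis A (hAB.trans (hE ▸ hB))
  obtain ⟨L, hL, hKL⟩ := hK.indep.subset_isBasis_of_subset (hK.subset.trans hAB) (hE ▸ hB)
  have hAL : A ∪ L ⊆ M.E := union_subset (hAB.trans hB) (hL.subset.trans hB)
  have hBcl : B ⊆ M.closure (A ∪ L) :=
    (hL.subset_closure.trans (N.closure_subset_closure subset_union_right)).trans (h _ hAL)
  -- Only `|L \ K| = rk_N(B) - rk_N(A)` elements are added to `A` to span `B` in `M`.
  have hAK : A ∪ L = A ∪ (L \ K) := by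
    rw [← union_sdiff_cancel hKL, ← union_assoc, union_eq_self_of_subset_right hK.subset]
    simp
  calc M.eRk B + N.eRk A ≤ M.eRk (A ∪ (L \ K)) + N.eRk A := by
        gcongr
        rw [← hAK, ← M.eRk_closure_eq (A ∪ L)]
        exact M.eRk_mono hBcl
    _ ≤ M.eRk A + (L \ K).encard + K.encard := by
        rw [hK.encard_eq_eRk]
        gcongr
        exact M.eRk_union_le_eRk_add_encard _ _
    _ = M.eRk A + N.eRk B := by
        rw [add_assoc, encard_sdiff_add_encard_of_subset hKL, hL.encard_eq_eRk]

theorem eRank_contract_add_eRk (M : Matroid α) (S : Set α) :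
    (M.contract S).eRank + M.eRk S = M.eRank := by
  obtain ⟨K, hK⟩ := M.exists_isBasis' S
  obtain ⟨I, hI⟩ := (M.contract S).exists_isBase
  obtain ⟨hd, hB⟩ := (hK.isBase_contract_iff I).1 hI
  rw [← hI.encard_eq_eRank, ← hK.encard_eq_eRk, ← hB.encard_eq_eRank,
    encard_union_eq (hd.mono_right hK.subset)]

end Matroid

theorem finsum_mem_exchange {α R : Type*} [AddCommGroup R] (y : α → R) {B : Set α} (hB : B.Finite)
    {j k : α} (hj : j ∉ B) (hk : k ∈ B) :
    ∑ᶠ b ∈ insert j (B \ {k}), y b = ∑ᶠ b ∈ B, y b + y j - y k := by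
  rw [finsum_mem_insert y (fun h ↦ hj h.1) hB.sdiff,
    ← finsum_mem_add_sdiff (f := y) (singleton_subset_iff.2 hk) hB, finsum_mem_singleton]
  abel

/-! ### Valuated covectors and transitivity. -/

namespace ValuatedMatroid

variable {α : Type*}

/-- A vector orthogonal to all valuated circuits of `ν` is, at every element `j` of its support,
touched from above by a translate of a valuated cocircuit of `ν`. -/
theorem exists_isBase_forall_le (ν : ValuatedMatroid α) (x : α → WithTop ℝ)
    (hx : ∀ B, ν.matroid.IsBase B → ∀ j ∈ ν.E \ B, x j ≠ ⊤ →
      ∃ k ∈ B, x k + ν.val (insert j (B \ {k})) ≤ x j + ν.val B)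
    {j : α} (hjE : j ∈ ν.E) (hj : x j ≠ ⊤) :
    ∃ B, ν.matroid.IsBase B ∧ j ∈ B ∧
      ∀ k ∉ B, x k + ν.val B ≤ x j + ν.val (insert k (B \ {j})) := by
  classical
  have hBfin : ∀ {B}, ν.matroid.IsBase B → B.Finite := fun hB ↦
    ν.finite_ground.subset hB.subset_ground
  have hfin : {B | ν.matroid.IsBase B}.Finite :=
    ν.finite_ground.finite_subsets.subset fun B hB ↦ Matroid.IsBase.subset_ground hB
  have hval : ∀ {B}, ν.matroid.IsBase B → ∃ r : ℝ, ν.val B = r := fun hB ↦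
    ⟨_, (WithTop.coe_untop _ ((ν.val_ne_top_iff _).2 hB)).symm⟩
  -- Bases are ordered first by the number of elements outside the support of `x`,
  -- then by the value of `ν - x`.
  let t : α → ℝ := fun k ↦ if x k = ⊤ then 1 else 0
  let c : Set α → ℝ := fun B ↦ ∑ᶠ b ∈ B, t b
  -- The default `0` is harmless: the values of `f` are evaluated only across exchanges of two
  -- elements at which `x` is finite.
  let f : Set α → ℝ := fun B ↦ (ν.val B).untopD 0 - ∑ᶠ b ∈ B, (x b).untopD 0
  obtain ⟨B₀, hB₀, hmax⟩ := hfin.exists_maximalFor c _ ν.matroid.exists_isBase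
  have hc : ∀ B, ν.matroid.IsBase B → c B ≤ c B₀ := fun B hB ↦
    (le_total (c B) (c B₀)).elim id (hmax hB)
  obtain ⟨B₁, ⟨hB₁, hcB₁⟩, hmin⟩ :=
    (hfin.subset (t := {B | ν.matroid.IsBase B ∧ c B = c B₀})
      fun B hB ↦ hB.1).exists_minimalFor f _ ⟨B₀, hB₀, rfl⟩
  have hf : ∀ B, ν.matroid.IsBase B → c B = c B₀ → f B₁ ≤ f B := fun B hB hcB ↦
    (le_total (f B₁) (f B)).elim id (hmin ⟨hB, hcB⟩)
  -- If the optimal basis misses `j`, orthogonality swaps `j` in for some `k` with `x k` finite, and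
  -- the result is still optimal.
  obtain ⟨B, hB, hcB, hfB, hjB⟩ :
      ∃ B, ν.matroid.IsBase B ∧ c B = c B₀ ∧ f B ≤ f B₁ ∧ j ∈ B := by
    by_cases hjB : j ∈ B₁
    · exact ⟨B₁, hB₁, hcB₁, le_rfl, hjB⟩
    obtain ⟨k, hk, hle⟩ := hx B₁ hB₁ j ⟨hjE, hjB⟩ hj
    obtain ⟨r, hr⟩ := hval hB₁
    obtain ⟨a, ha⟩ := WithTop.ne_top_iff_exists.1 hj
    rw [hr, ← ha] at hle
    have hne := (WithTop.add_ne_top.1 (ne_top_of_le_ne_top (by simp) hle))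
    have hB' := (ν.val_ne_top_iff _).1 hne.2
    obtain ⟨s, hs⟩ := hval hB'
    obtain ⟨b, hb⟩ := WithTop.ne_top_iff_exists.1 hne.1
    refine ⟨_, hB', ?_, ?_, mem_insert _ _⟩
    · rw [← hcB₁]
      simp only [c]
      rw [finsum_mem_exchange t (hBfin hB₁) hjB hk]
      simp [t, ← ha, ← hb]
    · simp only [f]
      rw [finsum_mem_exchange _ (hBfin hB₁) hjB hk, hr, hs, ← ha, ← hb]
      rw [hs, ← hb] at hle
      norm_cast at hle
      simp only [WithTop.untopD_coe]
      linarith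
  refine ⟨B, hB, hjB, fun k hk ↦ ?_⟩
  by_cases hB' : ν.matroid.IsBase (insert k (B \ {j}))
  swap
  · rw [not_not.1 (mt (ν.val_ne_top_iff _).1 hB'), add_top]
    exact le_top
  obtain ⟨a, ha⟩ := WithTop.ne_top_iff_exists.1 hj
  have hcB' := finsum_mem_exchange t (hBfin hB) hk hjB
  change c _ = c B + t k - t j at hcB'
  have htj : t j = 0 := by simp [t, hj]
  -- Swapping `j` for an element outside the support would increase `c` beyond its maximum.
  by_cases hxk : x k = ⊤
  · have htk : t k = 1 := by simp [t, hxk]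
    linarith [hc _ hB']
  have htk : t k = 0 := by simp [t, hxk]
  have hle := hfB.trans (hf _ hB' (by linarith))
  obtain ⟨b, hb⟩ := WithTop.ne_top_iff_exists.1 hxk
  obtain ⟨r, hr⟩ := hval hB
  obtain ⟨s, hs⟩ := hval hB'
  simp only [f] at hle
  rw [finsum_mem_exchange _ (hBfin hB) hk hjB, hr, hs, ← ha, ← hb] at hle
  simp only [WithTop.untopD_coe] at hle
  rw [hr, hs, ← ha, ← hb]
  norm_cast
  linarith

theorem ne_top_of_add_le {μ ν : ValuatedMatroid α} {I J : Set α} {a b : WithTop ℝ}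
    (hI : μ.matroid.IsBase I) (hJ : ν.matroid.IsBase J) (h : a + b ≤ μ.val I + ν.val J) :
    a ≠ ⊤ ∧ b ≠ ⊤ :=
  WithTop.add_ne_top.1 (ne_top_of_le_ne_top
    (WithTop.add_ne_top.2 ⟨(μ.val_ne_top_iff _).2 hI, (ν.val_ne_top_iff _).2 hJ⟩) h)

theorem IsQuotient.trans {μ ν ξ : ValuatedMatroid α} (hξν : ξ.IsQuotient ν)
    (hνμ : ν.IsQuotient μ) : ξ.IsQuotient μ := by
  classical
  refine ⟨hξν.1.trans hνμ.1, hξν.2.1.trans hνμ.2.1, fun I J hI hJ i hi ↦ ?_⟩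
  -- For `k ∈ I \ {i}` the set `insert k (I \ {i})` is too small to be a basis, so `⊤` is its actual
  -- value.
  let x : α → WithTop ℝ := fun k ↦ if k ∈ I \ {i} then ⊤ else ξ.val (insert k (I \ {i}))
  have hx : ∀ {k}, x k ≠ ⊤ → k ∉ I \ {i} ∧ x k = ξ.val (insert k (I \ {i})) := by
    intro k hk
    have hkI : k ∉ I \ {i} := fun h ↦ hk (if_pos h)
    exact ⟨hkI, if_neg hkI⟩
  have hxi : x i = ξ.val I := by simp [x, insert_eq_of_mem hi.1]
  have hiν : i ∈ ν.E := hξν.1 ▸ hI.subset_ground hi.1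
  obtain ⟨B, hB, hiB, hmin⟩ := ν.exists_isBase_forall_le x (by
      intro B hB j hj hxj
      obtain ⟨hjI, hxj'⟩ := hx hxj
      have hI' := (ξ.val_ne_top_iff _).1 (hxj' ▸ hxj)
      -- Exchanging `j` out of `I - i + j` gives `I - i + k`, so this is the orthogonality condition
      -- on `x`.
      obtain ⟨k, hk, hle⟩ := hξν.2.2 _ B hI' hB j ⟨mem_insert _ _, hj.2⟩
      refine ⟨k, hk.1, ?_⟩
      rw [insert_sdiff_self_of_notMem hjI] at hle
      rw [hxj']
      rwa [show x k = ξ.val (insert k (I \ {i})) from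
        if_neg fun h ↦ hk.2 (mem_insert_of_mem j h)])
    hiν (by rw [hxi]; exact (ξ.val_ne_top_iff _).2 hI)
  obtain ⟨j, hj, hle⟩ := hνμ.2.2 B J hB hJ i ⟨hiB, hi.2⟩
  have hmin' := hmin j hj.2
  have hne := ne_top_of_add_le hB hJ hle
  rw [hxi] at hmin'
  have hxj : x j ≠ ⊤ := (ne_top_of_add_le hI ((ν.val_ne_top_iff _).1 hne.1) hmin').1
  obtain ⟨hjI, hxj'⟩ := hx hxj
  have hji : j ≠ i := fun h ↦ hj.2 (h ▸ hiB)
  refine ⟨j, ⟨hj.1, fun h ↦ hjI ⟨h, hji⟩⟩, ?_⟩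
  rw [← hxj']
  obtain ⟨a, ha⟩ := WithTop.ne_top_iff_exists.1 hxj
  obtain ⟨b, hb⟩ := WithTop.ne_top_iff_exists.1 hne.1
  obtain ⟨c, hc⟩ := WithTop.ne_top_iff_exists.1 hne.2
  obtain ⟨d, hd⟩ := WithTop.ne_top_iff_exists.1 ((ν.val_ne_top_iff _).2 hB)
  obtain ⟨e, he⟩ := WithTop.ne_top_iff_exists.1 ((μ.val_ne_top_iff _).2 hJ)
  obtain ⟨g, hg⟩ := WithTop.ne_top_iff_exists.1 ((ξ.val_ne_top_iff _).2 hI)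
  rw [← hb, ← hc, ← hd, ← he] at hle
  rw [← ha, ← hb, ← hd, ← hg] at hmin'
  rw [← ha, ← hc, ← he, ← hg]
  norm_cast at hle hmin' ⊢
  linarith

theorem IsQuotient.eRk_add_eRk_le {μ ν : ValuatedMatroid α} (h : μ.IsQuotient ν) {A B : Set α}
    (hAB : A ⊆ B) (hB : B ⊆ μ.E) :
    μ.matroid.eRk B + ν.matroid.eRk A ≤ μ.matroid.eRk A + ν.matroid.eRk B :=
  Matroid.eRk_add_eRk_le_of_closure_subset h.1
    (fun _ hX ↦ Matroid.closure_subset_closure_of_exchange h.1 (fun I J hI hJ i hi ↦ by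
      obtain ⟨j, hj, hle⟩ := h.2.2 I J hI hJ i hi
      have hne := ne_top_of_add_le hI hJ hle
      exact ⟨j, hj, (μ.val_ne_top_iff _).1 hne.1, (ν.val_ne_top_iff _).1 hne.2⟩) hX) hAB hB

theorem eRk_ne_top (μ : ValuatedMatroid α) (X : Set α) : μ.matroid.eRk X ≠ ⊤ := by
  rw [← μ.matroid.eRk_inter_ground]
  exact ne_top_of_le_ne_top (encard_ne_top_iff.2 (μ.finite_ground.subset inter_subset_right))
    (μ.matroid.eRk_le_encard _)

theorem IsQuotient.matroid {μ ν : ValuatedMatroid α} (h : μ.IsQuotient ν) :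
    μ.matroid.IsQuotientOf ν.matroid := by
  refine ⟨h.1, fun A B hAB hB ↦ ?_⟩
  have hle := h.eRk_add_eRk_le hAB hB
  simp only [Matroid.intRk]
  rw [← ENat.natCast_toNat (μ.eRk_ne_top A), ← ENat.natCast_toNat (μ.eRk_ne_top B),
    ← ENat.natCast_toNat (ν.eRk_ne_top A), ← ENat.natCast_toNat (ν.eRk_ne_top B)] at hle
  norm_cast at hle
  omega

/-! ### Contraction and deletion. -/

/-- Slices of `μ` and `ν` satisfy the exchange property of a quotient if `μ` and `ν` do and if no
exchange between them uses an element of the fixed part of the slice of `ν`. -/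
theorem slice_exchange {μ ν : ValuatedMatroid α} {S K L : Set α} {M N : Matroid α}
    (h : ∀ I J, μ.matroid.IsBase I → ν.matroid.IsBase J → ∀ i ∈ I \ J, ∃ j ∈ J \ I,
      μ.val (insert j (I \ {i})) + ν.val (insert i (J \ {j})) ≤ μ.val I + ν.val J)
    (hKS : K ⊆ S) (hLS : L ⊆ S) (hEM : M.E ⊆ μ.matroid.E) (hEN : N.E ⊆ ν.matroid.E)
    (hM : ∀ I, M.IsBase I ↔ Disjoint I S ∧ μ.matroid.IsBase (I ∪ K))
    (hN : ∀ J, N.IsBase J ↔ Disjoint J S ∧ ν.matroid.IsBase (J ∪ L))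
    (hL : ∀ I J, M.IsBase I → N.IsBase J → ∀ i ∈ I \ J, ∀ j ∈ L \ K,
      μ.matroid.IsBase (insert j ((I ∪ K) \ {i})) →
      ¬ ν.matroid.IsBase (insert i ((J ∪ L) \ {j})))
    (I J : Set α) (hI : M.IsBase I) (hJ : N.IsBase J) (i : α) (hi : i ∈ I \ J) :
    ∃ j ∈ J \ I, (μ.slice S K M hKS hEM hM).val (insert j (I \ {i})) +
        (ν.slice S L N hLS hEN hN).val (insert i (J \ {j})) ≤
      (μ.slice S K M hKS hEM hM).val I + (ν.slice S L N hLS hEN hN).val J := by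
  obtain ⟨hdI, hIK⟩ := (hM I).1 hI
  obtain ⟨hdJ, hJL⟩ := (hN J).1 hJ
  have hiS : i ∉ S := disjoint_left.1 hdI hi.1
  have hiK : i ∉ K := fun hx ↦ hiS (hKS hx)
  obtain ⟨j, hj, hle⟩ := h _ _ hIK hJL i ⟨Or.inl hi.1, fun hx ↦ hx.elim hi.2 fun hx ↦ hiS (hLS hx)⟩
  have hne := ne_top_of_add_le hIK hJL hle
  have hjL : j ∉ L := fun hjL ↦ hL I J hI hJ i hi j ⟨hjL, fun hx ↦ hj.2 (Or.inr hx)⟩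
    ((μ.val_ne_top_iff _).1 hne.1) ((ν.val_ne_top_iff _).1 hne.2)
  have hjJ : j ∈ J := hj.1.resolve_right hjL
  have hjS : j ∉ S := disjoint_left.1 hdJ hjJ
  refine ⟨j, ⟨hjJ, fun hx ↦ hj.2 (Or.inl hx)⟩, ?_⟩
  have h1 : Disjoint (insert j (I \ {i})) S :=
    disjoint_insert_left.2 ⟨hjS, hdI.mono_left sdiff_subset⟩
  have h2 : Disjoint (insert i (J \ {j})) S :=
    disjoint_insert_left.2 ⟨hiS, hdJ.mono_left sdiff_subset⟩
  simp only [slice]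
  rw [if_pos h1, if_pos h2, if_pos hdI, if_pos hdJ, insert_union, insert_union]
  rwa [union_sdiff_distrib, union_sdiff_distrib, sdiff_singleton_eq_self hiK,
    sdiff_singleton_eq_self hjL] at hle

/-- Such a basis would contain `K + j`, an independent subset of `S` larger than `K`. This blocks
bad exchanges on the contraction side. -/
theorem not_isBase_insert_of_isBasis' {M : Matroid α} {S K I : Set α} {i j : α}
    (hK : M.IsBasis' K S) (hi : i ∉ S) (hjS : j ∈ S) (hjK : j ∉ K) :
    ¬ M.IsBase (insert j ((I ∪ K) \ {i})) := fun hB ↦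
  hjK (hK.mem_of_insert_indep hjS (hB.indep.subset (insert_subset_insert fun _ hx ↦
    ⟨Or.inr hx, fun hxi ↦ hi (hxi ▸ hK.subset hx)⟩)))

/-- Removing `j ∈ S` leaves `J` intact, so `J + i` would be independent in `E \ S`, where `J` is
already maximal. -/
theorem not_isBase_insert_of_isBase_delete {N : Matroid α} {S L J : Set α} {i j : α}
    (hJ : (N.delete S).IsBase J) (hi : i ∈ N.E \ S) (hiJ : i ∉ J) (hj : j ∈ S) :
    ¬ N.IsBase (insert i ((J ∪ L) \ {j})) := fun hB ↦
  hiJ ((N.delete_isBase_iff.1 hJ).mem_of_insert_indep hi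
    (hB.indep.subset (insert_subset_insert fun x hx ↦
      ⟨Or.inl hx, fun hxj ↦ (hJ.subset_ground hx).2 ((show x = j from hxj) ▸ hj)⟩)))

theorem IsQuotient.contract {μ ν : ValuatedMatroid α} (h : μ.IsQuotient ν) {S : Set α}
    (hS : S ⊆ μ.E) : (μ.contract S).IsQuotient (ν.contract S) := by
  refine ⟨congrArg (· \ S) h.1, ?_, slice_exchange h.2.2 _ _ _ _ _ _ ?_⟩
  -- The rank inequality for `S ⊆ E` compares the ranks of the two contractions, after cancelling
  -- the finite ranks of `S`.
  · have hle := h.eRk_add_eRk_le hS subset_rfl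
    rw [show μ.matroid.eRk μ.E = _ from μ.matroid.eRk_ground, h.1,
      show ν.matroid.eRk ν.E = _ from ν.matroid.eRk_ground, ← μ.matroid.eRank_contract_add_eRk S,
      ← ν.matroid.eRank_contract_add_eRk S, add_assoc, add_left_comm] at hle
    exact (ENat.add_le_add_iff_right (ν.eRk_ne_top S)).1
      ((ENat.add_le_add_iff_left (μ.eRk_ne_top S)).1 hle)
  · intro I J hI _ i hi j hj hB
    have hK := (μ.matroid.exists_isBasis' S).choose_spec
    exact absurd hB (not_isBase_insert_of_isBasis' hK (hI.subset_ground hi.1).2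
      ((ν.matroid.exists_isBasis' S).choose_spec.subset hj.1) hj.2)

theorem choose_subset_of_delete (μ : ValuatedMatroid α) (S : Set α) :
    (μ.matroid.contract (μ.matroid.E \ S)).exists_isBase.choose ⊆ S := by
  intro x hx
  have h := (μ.matroid.contract (μ.matroid.E \ S)).exists_isBase.choose_spec.subset_ground hx
  exact by_contra fun hxS ↦ h.2 ⟨h.1, hxS⟩

theorem eRank_delete (μ : ValuatedMatroid α) (S : Set α) :
    (μ.delete S).matroid.eRank = μ.matroid.eRk (μ.E \ S) := by
  change (μ.matroid.delete S).eRank = _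
  rw [Matroid.delete_eq_restrict, Matroid.eRank_restrict]
  rfl

theorem IsQuotient.delete {μ ν : ValuatedMatroid α} (h : μ.IsQuotient ν) (S : Set α) :
    (μ.delete S).IsQuotient (ν.delete S) := by
  refine ⟨congrArg (· \ S) h.1, ?_, slice_exchange h.2.2 _ _ _ _ _ _ ?_⟩
  · have hle := h.eRk_add_eRk_le (empty_subset (μ.E \ S)) sdiff_subset
    rwa [Matroid.eRk_empty, Matroid.eRk_empty, add_zero, zero_add, ← eRank_delete, h.1,
      ← eRank_delete] at hle
  · intro I J hI hJ i hi j hj _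
    have hiE := hI.subset_ground hi.1
    exact not_isBase_insert_of_isBase_delete hJ ⟨h.1.subset hiE.1, hiE.2⟩ hi.2
      (ν.choose_subset_of_delete S hj.1)

theorem contract_isQuotient_delete (μ : ValuatedMatroid α) {S : Set α} (hS : S ⊆ μ.E) :
    (μ.contract S).IsQuotient (μ.delete S) := by
  refine ⟨rfl, ?_, slice_exchange μ.exchange _ _ _ _ _ _ ?_⟩
  · rw [eRank_delete]
    change (μ.matroid.contract S).eRank ≤ _
    refine (ENat.add_le_add_iff_right (μ.eRk_ne_top S)).1 ?_
    rw [μ.matroid.eRank_contract_add_eRk, add_comm, ← μ.matroid.eRk_ground]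
    -- Subadditivity: `rk(E) - rk(S) ≤ rk(E \ S)`.
    have := μ.matroid.eRk_union_le_eRk_add_eRk S (μ.E \ S)
    rwa [union_sdiff_cancel hS] at this
  · intro I J hI _ i hi j hj hB
    exact absurd hB (not_isBase_insert_of_isBasis' (μ.matroid.exists_isBasis' S).choose_spec
      (hI.subset_ground hi.1).2 (μ.choose_subset_of_delete S hj.1) hj.2)

end ValuatedMatroid

theorem mainTheorem9 {α : Type*} (μ ν ξ : ValuatedMatroid α) :
    -- composition: if `ν` is a quotient of `μ` and `ξ` of `ν`, then `ξ` is a quotient of `μ`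
    (ν.IsQuotient μ → ξ.IsQuotient ν → ξ.IsQuotient μ) ∧
    -- contraction and deletion preserve quotients
    (μ.IsQuotient ν → ∀ S : Set α, S ⊆ μ.E →
      (μ.contract S).IsQuotient (ν.contract S) ∧ (μ.delete S).IsQuotient (ν.delete S)) ∧
    -- the contraction is a quotient of the deletion
    (∀ S : Set α, S ⊆ μ.E → (μ.contract S).IsQuotient (μ.delete S)) ∧
    -- the underlying matroids form a matroid quotient
    (μ.IsQuotient ν → μ.matroid.IsQuotientOf ν.matroid) := by
  exact ⟨fun h₁ h₂ ↦ h₂.trans h₁, fun h S hS ↦ ⟨h.contract hS, h.delete S⟩,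
    fun _ hS ↦ μ.contract_isQuotient_delete hS, fun h ↦ h.matroid⟩
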